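/- **Setting.** Consider $n$ periodic tasks $\tau_1,\dots,\tau_n$ on one processor under fixed-priority scheduling, indexed in decreasing order of (distinct) priorities, so that $hp(i)=\{j: j<i\}$ and $lp(i)=\{j: j>i\}$ are the tasks of higher and of lower priority than $\tau_i$. Task $\tau_i$ has worst-case execution time $C_i$, deadline $D_i$ and period $T_i$ (real numbers) with $0<C_i\le D_i\le T_i$. The first $n_c\le n$ tasks are critical, and $C_r\ge 0$ is the time of a system restart. Each task has a non-preemptive ending interval of length $Q_i$, $0\le Q_i\le C_i$. **Feasibility test.** Put $W_1=C_1$ and $W_i=C_i+\max(0,W_{i-1}-Q_i)$ for $i\ge 2$; let $O_i=C_r+W_i$ for $i\le n_c$ and $O_i=0$ for $i>n_c$. For a blocking time $B\ge 0$, let $L_i$ be the stationary value of the iteration $$L^{(q+1)}=B+C_i+\sum_{j\in hp(i)}\lceil L^{(q)}/T_j\rceil C_j+O_i ,\qquad L^{(0)}=0,$$ let $K_i=\lceil L_i/T_i\rceil$, and for $1\le k\le K_i$ let $S_{i,k}$ be the stationary value of the iteration $$S^{(q+1)}=B+(k-1)C_i+C_i-Q_i+\sum_{j\in hp(i)}\bigl(\lfloor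 S^{(q)}/T_j\rfloor+1\bigr)C_j+O_i ,\qquad S^{(0)}=0 .$$ The response time of $\tau_i$ under blocking $B$ is $R_i(B)=\max_{1\le k\le K_i}\{S_{i,k}+Q_i-(k-1)T_i\}$; it is undefined if one of these iterations does not become stationary. We say that $R_i(B)\le D_i$ holds if $R_i(B)$ is defined and at most $D_i$. The task set with lengths $Q_1,\dots,Q_n$ is *RBR-feasible* (feasible under restart-based recovery, according to this test) if $R_i(B_i)\le D_i$ for all $i$, where $B_i=\max_{k\in lp(i)}Q_k$ (and $B_n=0$). **Blocking tolerance.** $\beta_i$ is the supremum of the blocking times $b\ge 0$ with $R_i(b)\le D_i$ ($\beta_i=-\infty$ if there are none). It depends on $Q_1,\dots,Q_i$ only. **Theorem.** Let $Q_1,\dots,Q_n$ be determined recursively by $$Q_1=C_1,\qquad Q_i=\min\bigl\{\min\{\beta_j : j\in hp(i)\},\,C_i\bigr\}\quad(2\le i\le n),$$ and assume that $\beta_j\ge 0$ for all $j\in hp(i)$ and all $i$. Assume also that $\beta_j$ is a maximum (that is, $R_j(\beta_j)\le D_j$) whenever $Q_i=\beta_j$ for some $i\in lp(j)$. Then $0\le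 Q_i\le C_i$ for all $i$, and these lengths are optimal: if there are any lengths $Q_1',\dots,Q_n'$ with $0\le Q_i'\le C_i$ for all $i$ under which the task set is RBR-feasible, then it is RBR-feasible under $Q_1,\dots,Q_n$. -/

import Mathlib

/-- A set of `n` periodic tasks under fixed priority scheduling on one processor, indexed in
decreasing order of priority (index `0` is the task of highest priority; priorities are distinct).
The first `nc` tasks are the critical ones, and `Cr` is the time that a system restart takes. -/
structure RBRTaskSet (n : ℕ) where
  /-- worst-case execution times -/
  C : Fin n → ℝ
  /-- periods -/
  T : Fin n → ℝ
  /-- relative deadlines -/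
  D : Fin n → ℝ
  /-- phases (the response-time test does not depend on them) -/
  phase : Fin n → ℝ
  /-- number of critical tasks -/
  nc : ℕ
  /-- restart time -/
  Cr : ℝ
  C_pos : ∀ i, 0 < C i
  C_le_D : ∀ i, C i ≤ D i
  D_le_T : ∀ i, D i ≤ T i
  nc_le : nc ≤ n
  Cr_nonneg : 0 ≤ Cr

namespace RBRTaskSet

variable {n : ℕ}

/-- Tasks of higher priority than task `i`. -/
def hp (i : Fin n) : Finset (Fin n) := Finset.univ.filter (fun j => j < i)

/-- Tasks of lower priority than task `i`. -/
def lp (i : Fin n) : Finset (Fin n) := Finset.univ.filter (fun j => i < j)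

/-- The iteration `x ↦ f x`, started at `0`, becomes stationary, at the value `x`. -/
def StabilizesAt (f : ℝ → ℝ) (x : ℝ) : Prop :=
  ∃ q : ℕ, f^[q] 0 = x ∧ f^[q + 1] 0 = x

/-- Possible lengths of the non-preemptive ending intervals: `0 ≤ Q i ≤ C i`. -/
def Admissible (𝒯 : RBRTaskSet n) (Q : Fin n → ℝ) : Prop :=
  ∀ i, 0 ≤ Q i ∧ Q i ≤ 𝒯.C i

/-- Worst-case wasted execution, recursively along the priority order. -/
noncomputable def wcweAux (𝒯 : RBRTaskSet n) (Q : Fin n → ℝ) : (i : ℕ) → i < n → ℝ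
  | 0, h => 𝒯.C ⟨0, h⟩
  | i + 1, h =>
      𝒯.C ⟨i + 1, h⟩ + max 0 (wcweAux 𝒯 Q i (Nat.lt_of_succ_lt h) - Q ⟨i + 1, h⟩)

/-- Worst-case wasted execution of task `i`. -/
noncomputable def wcwe (𝒯 : RBRTaskSet n) (Q : Fin n → ℝ) (i : Fin n) : ℝ :=
  𝒯.wcweAux Q i.val i.isLt

/-- Worst-case restart overhead on the response time of task `i`; only critical tasks
account for restarts. -/
noncomputable def overhead (𝒯 : RBRTaskSet n) (Q : Fin n → ℝ) (i : Fin n) : ℝ :=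
  if i.val < 𝒯.nc then 𝒯.Cr + 𝒯.wcwe Q i else 0

/-- Blocking term: the longest non-preemptive ending interval among the tasks of lower priority
(`0` if there are none). -/
noncomputable def blocking (Q : Fin n → ℝ) (i : Fin n) : ℝ :=
  if h : (lp i).Nonempty then (lp i).sup' h Q else 0

/-- Right-hand side of the iteration for the length of the active period of task `i`,
with blocking term `B`. -/
noncomputable def activeMap (𝒯 : RBRTaskSet n) (Q : Fin n → ℝ) (i : Fin n) (B x : ℝ) : ℝ :=
  B + 𝒯.C i + (∑ j ∈ hp i, (⌈x / 𝒯.T j⌉ : ℝ) * 𝒯.C j) + 𝒯.overhead Q i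

/-- Right-hand side of the iteration for the worst-case start time of the non-preemptive ending
interval of the `k`-th job of task `i`, with blocking term `B`. -/
noncomputable def startMap (𝒯 : RBRTaskSet n) (Q : Fin n → ℝ) (i : Fin n) (B : ℝ) (k : ℕ)
    (x : ℝ) : ℝ :=
  B + ((k : ℝ) - 1) * 𝒯.C i + 𝒯.C i - Q i
    + (∑ j ∈ hp i, ((⌊x / 𝒯.T j⌋ : ℝ) + 1) * 𝒯.C j) + 𝒯.overhead Q i

/-- `R` is the worst-case response time of task `i` when its blocking term is `B`:
`L` is the length of the active period, `⌈L / T i⌉` the number of jobs to examine, and `S k`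
the worst-case start time of the ending interval of the `k`-th job. There is no such `R` if one
of the iterations does not become stationary. -/
def IsResponseTime (𝒯 : RBRTaskSet n) (Q : Fin n → ℝ) (i : Fin n) (B R : ℝ) : Prop :=
  ∃ (L : ℝ) (S : ℕ → ℝ), StabilizesAt (𝒯.activeMap Q i B) L ∧
    (∀ k ∈ Set.Icc 1 ⌈L / 𝒯.T i⌉₊, StabilizesAt (𝒯.startMap Q i B k) (S k)) ∧
    IsGreatest
      ((fun k : ℕ => S k + Q i - ((k : ℝ) - 1) * 𝒯.T i) '' Set.Icc 1 ⌈L / 𝒯.T i⌉₊) R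

/-- Task `i` meets its deadline when its blocking term is `B`. -/
def MeetsDeadline (𝒯 : RBRTaskSet n) (Q : Fin n → ℝ) (i : Fin n) (B : ℝ) : Prop :=
  ∃ R, 𝒯.IsResponseTime Q i B R ∧ R ≤ 𝒯.D i

/-- The response-time test for RBR-feasibility with ending intervals of lengths `Q`:
every task has a response time, and it is at most the deadline. -/
def RBRFeasible (𝒯 : RBRTaskSet n) (Q : Fin n → ℝ) : Prop :=
  ∀ i, 𝒯.MeetsDeadline Q i (blocking Q i)

/-- Blocking times under which task `i` still meets its deadline. This set depends on `Q` only
through its values at `i` and at the tasks of higher priority. -/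
def tolerable (𝒯 : RBRTaskSet n) (Q : Fin n → ℝ) (i : Fin n) : Set ℝ :=
  {b | 0 ≤ b ∧ 𝒯.MeetsDeadline Q i b}

/-- Blocking tolerance of task `i`: the supremum of the tolerable blocking times; it is `⊥` if the
task misses its deadline even without blocking. -/
noncomputable def blockingTolerance (𝒯 : RBRTaskSet n) (Q : Fin n → ℝ) (i : Fin n) : EReal :=
  sSup ((fun b : ℝ => (b : EReal)) '' 𝒯.tolerable Q i)

/-- The lengths `Q i = min (min_{j ∈ hp i} β j) (C i)`. The infimum over the empty set is `⊤`, so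
this says `Q = C` at the task of highest priority. As `β j` depends on `Q` only up to index `j`,
this determines `Q` recursively. -/
def IsMinToleranceChoice (𝒯 : RBRTaskSet n) (Q : Fin n → ℝ) : Prop :=
  ∀ i, (Q i : EReal) = min (⨅ j ∈ hp i, 𝒯.blockingTolerance Q j) (𝒯.C i : EReal)

end RBRTaskSet

/-! The test is monotone (`MeetsDeadline.mono`): less blocking, or longer ending intervals at a task
and above it, never hurts. Longer intervals reduce wasted execution, and the task's own start
advances by at least what its interval gains. Let `Q'` be feasible. By induction on priority `Q' ≤
Q`: if this holds above `i`, each `j < i` tolerates under `Q` its blocking under `Q'`, which is at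
least `Q' i`; so `Q' i` is below every tolerance in the minimum (`ge_of_feasible`). Under `Q`,
blocking of a task is some `Q k` within its tolerance, hence harmless. Only the lowest task, which
is never blocked, needs the comparison with `Q'`. -/

namespace RBRTaskSet

/-! ### Stationary values of monotone iterations -/

section Stabilization

theorem StabilizesAt.eq {f : ℝ → ℝ} {x : ℝ} (h : StabilizesAt f x) : f x = x := by
  obtain ⟨q, h1, h2⟩ := h
  rw [Function.iterate_succ_apply', h1] at h2
  exact h2

theorem StabilizesAt.nonneg {f : ℝ → ℝ} {x : ℝ} (hf : Monotone f) (h0 : 0 ≤ f 0)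
    (h : StabilizesAt f x) : 0 ≤ x := by
  obtain ⟨q, h1, -⟩ := h
  have := hf.monotone_iterate_of_le_map h0 (Nat.zero_le q)
  simpa [h1] using this

/-- The iteration from `0` of a monotone map becomes stationary below any point `y` that the map
does not increase, provided that the map takes only finitely many values on `[0, y]`. -/
theorem exists_stabilizesAt_le {f : ℝ → ℝ} (hf : Monotone f) (h0 : 0 ≤ f 0) {y : ℝ} (hy : 0 ≤ y)
    (hfy : f y ≤ y) (hfin : (f '' Set.Icc 0 y).Finite) :
    ∃ x ≤ y, StabilizesAt f x := by
  have hmono : Monotone (fun q => f^[q] 0) := hf.monotone_iterate_of_le_map h0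
  have hmem : ∀ q, f^[q] 0 ∈ Set.Icc 0 y := by
    intro q
    refine ⟨by simpa using hmono (Nat.zero_le q), ?_⟩
    induction q with
    | zero => simpa using hy
    | succ q ih =>
      rw [Function.iterate_succ_apply']
      exact (hf ih).trans hfy
  -- The shift by one puts every iterate considered into the finite image of `f`.
  have hnot : ¬ Function.Injective (fun q => f^[q + 1] 0) := by
    intro hinj
    refine Set.infinite_range_of_injective hinj (hfin.subset ?_)
    rintro _ ⟨q, rfl⟩
    exact ⟨f^[q] 0, hmem q, (Function.iterate_succ_apply' f q 0).symm⟩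
  obtain ⟨a, b, hab, hlt⟩ : ∃ a b, f^[a] 0 = f^[b] 0 ∧ a < b := by
    simp only [Function.Injective, not_forall] at hnot
    obtain ⟨a, b, hab, hne⟩ := hnot
    rcases lt_or_gt_of_ne hne with h | h
    · exact ⟨a + 1, b + 1, hab, by omega⟩
    · exact ⟨b + 1, a + 1, hab.symm, by omega⟩
  -- The iterates increase, so a repeated value is constant in between.
  refine ⟨f^[a] 0, (hmem a).2, a, rfl, le_antisymm ?_ (hmono (Nat.le_succ a))⟩
  rw [hab]
  exact hmono hlt

theorem monotone_const_add_sum {ι : Type*} (s : Finset ι) {m : ι → ℝ → ℤ}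
    (hm : ∀ j, Monotone (m j)) {c : ι → ℝ} (hc : ∀ j, 0 ≤ c j) (a : ℝ) :
    Monotone (fun x => a + ∑ j ∈ s, (m j x : ℝ) * c j) := by
  intro x y hxy
  refine add_le_add_right (Finset.sum_le_sum fun j _ => ?_) a
  exact mul_le_mul_of_nonneg_right (by exact_mod_cast hm j hxy) (hc j)

/-- The integer vectors `m · x` lie in the box between their values at `0` and `y`. -/
theorem finite_image_const_add_sum {ι : Type*} [Finite ι] (s : Finset ι) {m : ι → ℝ → ℤ}
    (hm : ∀ j, Monotone (m j)) (c : ι → ℝ) (a y : ℝ) :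
    ((fun x => a + ∑ j ∈ s, (m j x : ℝ) * c j) '' Set.Icc 0 y).Finite := by
  classical
  have := Fintype.ofFinite ι
  have h1 : ((fun x j => m j x) '' Set.Icc 0 y).Finite := by
    refine (Set.finite_Icc (fun j => m j 0) (fun j => m j y)).subset ?_
    rintro _ ⟨x, hx, rfl⟩
    exact ⟨fun j => hm j hx.1, fun j => hm j hx.2⟩
  refine (h1.image fun v : ι → ℤ => a + ∑ j ∈ s, (v j : ℝ) * c j).subset ?_
  rintro _ ⟨x, hx, rfl⟩
  exact ⟨_, ⟨x, hx, rfl⟩, rfl⟩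

end Stabilization

/-! ### Monotonicity of the response-time test -/

variable {n : ℕ} (𝒯 : RBRTaskSet n)

theorem T_pos (i : Fin n) : 0 < 𝒯.T i :=
  ((𝒯.C_pos i).trans_le (𝒯.C_le_D i)).trans_le (𝒯.D_le_T i)

theorem wcweAux_nonneg (Q : Fin n → ℝ) (i : ℕ) (h : i < n) : 0 ≤ 𝒯.wcweAux Q i h := by
  cases i with
  | zero => exact (𝒯.C_pos _).le
  | succ i => exact add_nonneg (𝒯.C_pos _).le (le_max_left _ _)

theorem wcweAux_anti {Q Q' : Fin n → ℝ} (i : ℕ) (h : i < n)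
    (hQ : ∀ j : Fin n, j.val ≤ i → Q' j ≤ Q j) : 𝒯.wcweAux Q i h ≤ 𝒯.wcweAux Q' i h := by
  induction i with
  | zero => exact le_rfl
  | succ i ih =>
    refine add_le_add_right (max_le_max le_rfl (sub_le_sub ?_ (hQ _ le_rfl))) _
    exact ih _ fun j hj => hQ j (hj.trans (Nat.le_succ i))

theorem overhead_nonneg (Q : Fin n → ℝ) (i : Fin n) : 0 ≤ 𝒯.overhead Q i := by
  unfold overhead
  split_ifs
  · exact add_nonneg 𝒯.Cr_nonneg (𝒯.wcweAux_nonneg Q _ _)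
  · exact le_rfl

theorem overhead_anti {Q Q' : Fin n → ℝ} {i : Fin n} (hQ : ∀ j ≤ i, Q' j ≤ Q j) :
    𝒯.overhead Q i ≤ 𝒯.overhead Q' i := by
  unfold overhead
  split_ifs
  · exact add_le_add_right (𝒯.wcweAux_anti _ _ fun j hj => hQ j hj) _
  · exact le_rfl

theorem activeMap_eq (Q : Fin n → ℝ) (i : Fin n) (B : ℝ) :
    𝒯.activeMap Q i B = fun x =>
      (B + 𝒯.C i + 𝒯.overhead Q i) + ∑ j ∈ hp i, ((⌈x / 𝒯.T j⌉ : ℤ) : ℝ) * 𝒯.C j := by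
  funext x
  unfold activeMap
  ring

theorem startMap_eq (Q : Fin n → ℝ) (i : Fin n) (B : ℝ) (k : ℕ) :
    𝒯.startMap Q i B k = fun x =>
      (B + ((k : ℝ) - 1) * 𝒯.C i + 𝒯.C i - Q i + 𝒯.overhead Q i)
        + ∑ j ∈ hp i, ((⌊x / 𝒯.T j⌋ + 1 : ℤ) : ℝ) * 𝒯.C j := by
  funext x
  unfold startMap
  push_cast
  ring

theorem monotone_ceil_div (j : Fin n) : Monotone fun x : ℝ => ⌈x / 𝒯.T j⌉ := fun _ _ h =>
  Int.ceil_mono (div_le_div_of_nonneg_right h (𝒯.T_pos j).le)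

theorem monotone_floor_div_add_one (j : Fin n) : Monotone fun x : ℝ => ⌊x / 𝒯.T j⌋ + 1 :=
  fun _ _ h => add_le_add_left (Int.floor_mono (div_le_div_of_nonneg_right h (𝒯.T_pos j).le)) 1

theorem monotone_activeMap (Q : Fin n → ℝ) (i : Fin n) (B : ℝ) :
    Monotone (𝒯.activeMap Q i B) := by
  rw [activeMap_eq]
  exact monotone_const_add_sum _ 𝒯.monotone_ceil_div (fun j => (𝒯.C_pos j).le) _

theorem monotone_startMap (Q : Fin n → ℝ) (i : Fin n) (B : ℝ) (k : ℕ) :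
    Monotone (𝒯.startMap Q i B k) := by
  rw [startMap_eq]
  exact monotone_const_add_sum _ 𝒯.monotone_floor_div_add_one (fun j => (𝒯.C_pos j).le) _

theorem C_le_activeMap (Q : Fin n → ℝ) (i : Fin n) {B x : ℝ} (hB : 0 ≤ B) (hx : 0 ≤ x) :
    𝒯.C i ≤ 𝒯.activeMap Q i B x := by
  have h : 0 ≤ ∑ j ∈ hp i, (⌈x / 𝒯.T j⌉ : ℝ) * 𝒯.C j := Finset.sum_nonneg fun j _ =>
    mul_nonneg (by exact_mod_cast Int.ceil_nonneg (div_nonneg hx (𝒯.T_pos j).le)) (𝒯.C_pos j).le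
  have := 𝒯.overhead_nonneg Q i
  unfold activeMap
  linarith

/-- At `x = 0` this makes the iteration start upwards; at a fixed point `S` it bounds `S + Q i`
below by `C i`. -/
theorem C_sub_le_startMap (Q : Fin n → ℝ) (i : Fin n) {B x : ℝ} {k : ℕ} (hk : 1 ≤ k)
    (hB : 0 ≤ B) (hx : 0 ≤ x) : 𝒯.C i - Q i ≤ 𝒯.startMap Q i B k x := by
  have h : 0 ≤ ∑ j ∈ hp i, ((⌊x / 𝒯.T j⌋ : ℝ) + 1) * 𝒯.C j := Finset.sum_nonneg fun j _ =>
    mul_nonneg (add_nonneg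
      (by exact_mod_cast Int.floor_nonneg.2 (div_nonneg hx (𝒯.T_pos j).le)) zero_le_one)
      (𝒯.C_pos j).le
  have h1 := 𝒯.overhead_nonneg Q i
  have h2 : 0 ≤ ((k : ℝ) - 1) * 𝒯.C i :=
    mul_nonneg (sub_nonneg.2 (by exact_mod_cast hk)) (𝒯.C_pos i).le
  unfold startMap
  linarith

/-- A shorter active period: less blocking and longer ending intervals. -/
theorem exists_activeMap_stabilizesAt_le {Q Q' : Fin n → ℝ} {i : Fin n} {B B' L : ℝ}
    (hQ : ∀ j ≤ i, Q' j ≤ Q j) (hB : 0 ≤ B) (hBB' : B ≤ B')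
    (hL : StabilizesAt (𝒯.activeMap Q' i B') L) :
    ∃ L' ≤ L, StabilizesAt (𝒯.activeMap Q i B) L' := by
  have h0 {P : Fin n → ℝ} {b : ℝ} (hb : 0 ≤ b) : 0 ≤ 𝒯.activeMap P i b 0 :=
    (𝒯.C_pos i).le.trans (𝒯.C_le_activeMap P i hb le_rfl)
  refine exists_stabilizesAt_le (𝒯.monotone_activeMap Q i B) (h0 hB)
    (hL.nonneg (𝒯.monotone_activeMap _ _ _) (h0 (hB.trans hBB'))) ?_ ?_
  · have h := hL.eq
    have := 𝒯.overhead_anti hQ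
    unfold activeMap at h ⊢
    linarith
  · rw [activeMap_eq]
    exact finite_image_const_add_sum _ 𝒯.monotone_ceil_div _ _ _

/-- An earlier finishing time: less blocking and longer ending intervals. -/
theorem exists_startMap_stabilizesAt_le {Q Q' : Fin n → ℝ} {i : Fin n} {B B' S : ℝ} {k : ℕ}
    (hk : 1 ≤ k) (hQ : ∀ j ≤ i, Q' j ≤ Q j) (hQC : Q i ≤ 𝒯.C i) (hB : 0 ≤ B) (hBB' : B ≤ B')
    (hS : StabilizesAt (𝒯.startMap Q' i B' k) S) :
    ∃ S', S' + Q i ≤ S + Q' i ∧ StabilizesAt (𝒯.startMap Q i B k) S' := by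
  have h0 {P : Fin n → ℝ} {b : ℝ} (hP : P i ≤ 𝒯.C i) (hb : 0 ≤ b) :
      0 ≤ 𝒯.startMap P i b k 0 :=
    (sub_nonneg.2 hP).trans (𝒯.C_sub_le_startMap P i hk hb le_rfl)
  have hQi := hQ i le_rfl
  have hS0 : 0 ≤ S :=
    hS.nonneg (𝒯.monotone_startMap _ _ _ _) (h0 (hQi.trans hQC) (hB.trans hBB'))
  have hSC := 𝒯.C_sub_le_startMap Q' i hk (hB.trans hBB') hS0
  have h := hS.eq
  rw [h] at hSC
  -- The barrier is the start that keeps the old finishing time `S + Q' i`. It is at least `C i - Q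
  -- i ≥ 0`, and at most `S`, so the interference does not grow.
  obtain ⟨S', hle, hstab⟩ := exists_stabilizesAt_le (y := S + Q' i - Q i)
    (𝒯.monotone_startMap Q i B k) (h0 hQC hB) (by linarith) (by
      have h1 := 𝒯.overhead_anti hQ
      have h2 := 𝒯.monotone_startMap Q i B k (show S + Q' i - Q i ≤ S by linarith)
      refine h2.trans ?_
      unfold startMap at h ⊢
      linarith) (by
      rw [startMap_eq]
      exact finite_image_const_add_sum _ 𝒯.monotone_floor_div_add_one _ _ _)
  exact ⟨S', by linarith, hstab⟩

/-- A task that meets its deadline still does so with less blocking and with longer ending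
intervals of itself and of the tasks of higher priority. -/
theorem MeetsDeadline.mono {Q Q' : Fin n → ℝ} {i : Fin n} {B B' : ℝ}
    (h : 𝒯.MeetsDeadline Q' i B') (hQ : ∀ j ≤ i, Q' j ≤ Q j) (hQC : Q i ≤ 𝒯.C i)
    (hB : 0 ≤ B) (hBB' : B ≤ B') : 𝒯.MeetsDeadline Q i B := by
  obtain ⟨R, ⟨L, S, hL, hS, hR⟩, hRD⟩ := h
  obtain ⟨L', hLL, hL'⟩ := 𝒯.exists_activeMap_stabilizesAt_le hQ hB hBB' hL
  have hsub : ∀ k ∈ Set.Icc 1 ⌈L' / 𝒯.T i⌉₊, k ∈ Set.Icc 1 ⌈L / 𝒯.T i⌉₊ := fun k hk =>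
    ⟨hk.1, hk.2.trans (Nat.ceil_mono (div_le_div_of_nonneg_right hLL (𝒯.T_pos i).le))⟩
  have hex : ∀ k, ∃ s, k ∈ Set.Icc 1 ⌈L' / 𝒯.T i⌉₊ →
      s + Q i ≤ S k + Q' i ∧ StabilizesAt (𝒯.startMap Q i B k) s := by
    intro k
    by_cases hk : k ∈ Set.Icc 1 ⌈L' / 𝒯.T i⌉₊
    · obtain ⟨s, hs⟩ :=
        𝒯.exists_startMap_stabilizesAt_le hk.1 hQ hQC hB hBB' (hS k (hsub k hk))
      exact ⟨s, fun _ => hs⟩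
    · exact ⟨0, fun h => absurd h hk⟩
  choose S' hS' using hex
  have hL'pos : 0 < L' := by
    have h0 : 0 ≤ L' := hL'.nonneg (𝒯.monotone_activeMap _ _ _)
      ((𝒯.C_pos i).le.trans (𝒯.C_le_activeMap Q i hB le_rfl))
    have := 𝒯.C_le_activeMap Q i hB h0
    rw [hL'.eq] at this
    exact (𝒯.C_pos i).trans_le this
  -- At least one job is examined; a maximum over no jobs would not exist.
  have hne : (Set.Icc 1 ⌈L' / 𝒯.T i⌉₊).Nonempty :=
    ⟨1, le_rfl, Nat.ceil_pos.2 (div_pos hL'pos (𝒯.T_pos i))⟩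
  obtain ⟨k, hk, hmax⟩ := (Set.finite_Icc 1 ⌈L' / 𝒯.T i⌉₊).exists_maximalFor
    (fun k : ℕ => S' k + Q i - ((k : ℝ) - 1) * 𝒯.T i) _ hne
  refine ⟨_, ⟨L', S', hL', fun k hk => (hS' k hk).2, ⟨k, hk, rfl⟩, ?_⟩, ?_⟩
  · rintro _ ⟨l, hl, rfl⟩
    exact (le_total _ _).elim id fun h => hmax hl h
  · have h1 : S k + Q' i - ((k : ℝ) - 1) * 𝒯.T i ≤ R := hR.2 ⟨k, hsub k hk, rfl⟩
    have h2 := (hS' k hk).1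
    simp only
    linarith

/-! ### Blocking terms and optimality -/

theorem mem_hp_iff_mem_lp {i j : Fin n} : j ∈ hp i ↔ i ∈ lp j := by
  simp [hp, lp]

theorem le_blocking {Q : Fin n → ℝ} {i k : Fin n} (hk : k ∈ lp i) : Q k ≤ blocking Q i := by
  unfold blocking
  rw [dif_pos ⟨k, hk⟩]
  exact Finset.le_sup' Q hk

/-- Whether lower tasks exist does not depend on the lengths, so the second case serves `Q` and `Q'`
at once. -/
theorem blocking_eq_or (Q : Fin n → ℝ) (i : Fin n) :
    (∃ k ∈ lp i, blocking Q i = Q k) ∨ ∀ P : Fin n → ℝ, blocking P i = 0 := by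
  by_cases h : (lp i).Nonempty
  · obtain ⟨k, hk, hk'⟩ := Finset.exists_mem_eq_sup' h Q
    exact Or.inl ⟨k, hk, by rw [blocking, dif_pos h, hk']⟩
  · exact Or.inr fun P => dif_neg h

theorem blocking_nonneg {Q : Fin n → ℝ} (hQ : ∀ i, 0 ≤ Q i) (i : Fin n) : 0 ≤ blocking Q i := by
  rcases blocking_eq_or Q i with ⟨k, -, hk⟩ | h
  · exact hk ▸ hQ k
  · exact (h Q).ge

variable {𝒯}

theorem IsMinToleranceChoice.le_C {Q : Fin n → ℝ} (hQ : 𝒯.IsMinToleranceChoice Q) (i : Fin n) :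
    Q i ≤ 𝒯.C i :=
  EReal.coe_le_coe_iff.1 ((hQ i).trans_le (min_le_right _ _))

theorem IsMinToleranceChoice.le_blockingTolerance {Q : Fin n → ℝ}
    (hQ : 𝒯.IsMinToleranceChoice Q) {i j : Fin n} (hj : j ∈ hp i) :
    (Q i : EReal) ≤ 𝒯.blockingTolerance Q j :=
  (hQ i).trans_le ((min_le_left _ _).trans (iInf₂_le j hj))

theorem IsMinToleranceChoice.admissible {Q : Fin n → ℝ} (hQ : 𝒯.IsMinToleranceChoice Q)
    (hβ : ∀ i, ∀ j ∈ hp i, 0 ≤ 𝒯.blockingTolerance Q j) : 𝒯.Admissible Q := fun i =>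
  ⟨EReal.coe_nonneg.1 <| (hQ i).symm ▸
    le_min (le_iInf₂ fun j hj => hβ i j hj) (EReal.coe_nonneg.2 (𝒯.C_pos i).le), hQ.le_C i⟩

/-- The lengths of the ending intervals given by the blocking tolerances are the longest ones under
which the task set can be feasible. -/
theorem IsMinToleranceChoice.ge_of_feasible {Q Q' : Fin n → ℝ} (hQ : 𝒯.IsMinToleranceChoice Q)
    (hQ' : 𝒯.Admissible Q') (hf : 𝒯.RBRFeasible Q') (i : Fin n) : Q' i ≤ Q i := by
  induction i using WellFoundedLT.induction with
  | ind i ih =>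
    rw [← EReal.coe_le_coe_iff, hQ i]
    refine le_min (le_iInf₂ fun j hj => ?_) (EReal.coe_le_coe_iff.2 (hQ' i).2)
    have hji : j < i := by simpa [hp] using hj
    have hb := blocking_nonneg (fun k => (hQ' k).1) j
    refine (EReal.coe_le_coe_iff.2 (le_blocking (mem_hp_iff_mem_lp.1 hj))).trans (le_sSup ?_)
    exact ⟨_, ⟨hb, (hf j).mono 𝒯 (fun k hk => ih k (hk.trans_lt hji)) (hQ.le_C j) hb le_rfl⟩, rfl⟩

end RBRTaskSet

theorem mainTheorem4 {n : ℕ} (𝒯 : RBRTaskSet n) (Q : Fin n → ℝ)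
    (hQ : 𝒯.IsMinToleranceChoice Q)
    (hβ : ∀ i, ∀ j ∈ RBRTaskSet.hp i, 0 ≤ 𝒯.blockingTolerance Q j)
    (hmax : ∀ i, ∀ j ∈ RBRTaskSet.hp i, (Q i : EReal) = 𝒯.blockingTolerance Q j →
      ∃ b ∈ 𝒯.tolerable Q j, (b : EReal) = 𝒯.blockingTolerance Q j) :
    𝒯.Admissible Q ∧
      ((∃ Q' : Fin n → ℝ, 𝒯.Admissible Q' ∧ 𝒯.RBRFeasible Q') → 𝒯.RBRFeasible Q) := by
  have hadm := hQ.admissible hβ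
  refine ⟨hadm, ?_⟩
  rintro ⟨Q', hQ', hf⟩ i
  rcases RBRTaskSet.blocking_eq_or Q i with ⟨k, hk, hBk⟩ | h0
  · have hik := RBRTaskSet.mem_hp_iff_mem_lp.2 hk
    obtain ⟨b, hb, hkb⟩ : ∃ b ∈ 𝒯.tolerable Q i, Q k ≤ b := by
      -- Strictly below the supremum some tolerable `b` lies above `Q k`; at equality the supremum
      -- must be attained.
      rcases (hQ.le_blockingTolerance hik).eq_or_lt with h | h
      · obtain ⟨b, hb, hb'⟩ := hmax k i hik h
        exact ⟨b, hb, EReal.coe_le_coe_iff.1 (h.trans hb'.symm).le⟩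
      · obtain ⟨_, ⟨b, hb, rfl⟩, hlt⟩ := lt_sSup_iff.1 h
        exact ⟨b, hb, (EReal.coe_lt_coe_iff.1 hlt).le⟩
    rw [hBk]
    exact hb.2.mono 𝒯 (fun _ _ => le_rfl) (hadm i).2 (hadm k).1 hkb
  · have h := hf i
    rw [h0] at h ⊢
    exact h.mono 𝒯 (fun j _ => hQ.ge_of_feasible hQ' hf j) (hadm i).2 le_rfl le_rfl
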